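/- Let $X$ be a countable set and let $G_2 : X\times X\to\mathbb{R}$ be a symmetric function with $G_2(x,y)\ge 1$ for all $x,y\in X$ with $x\ne y$. Assume that $$b := \sup_{x\in X}\ \prod_{y\in X\setminus\{x\}} G_2(x,y) < \infty .$$ Then for every real $\rho$ with $0\le\rho\le 1/b$ the pair $(\rho,G_2)$ is realizable, that is, there is a probability measure $\mu$ on $\{0,1\}^X$ (with the product $\sigma$-algebra) such that, writing $\eta(x)\in\{0,1\}$ for the occupation of the site $x$ and $\langle\cdot\rangle$ for the expectation with respect to $\mu$, $$\langle\eta(x)\rangle=\rho \quad\text{for all } x\in X, \qquad \langle\eta(x)\eta(y)\rangle=\rho^2\,G_2(x,y)\quad\text{for all } x,y\in X,\ x\ne y .$$ -/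

import Mathlib

open scoped ENNReal

namespace LatticePointProcess

/-- Configurations of a lattice gas on the set of sites `X`, as elements of `{0,1}^X` with the
product sigma-algebra: `ω x = true` when the site `x` is occupied. -/
abbrev Configuration (X : Type*) : Type _ := X → Bool

/-- The empirical field `η(x)`: it is `1` if the site `x` is occupied and `0` if it is empty. -/
def empiricalField {X : Type*} (x : X) (ω : Configuration X) : ℝ :=
  if ω x = true then 1 else 0

theorem measurable_empiricalField {X : Type*} (x : X) :
    Measurable (empiricalField x : Configuration X → ℝ) :=
  (measurable_of_countable (fun c : Bool => if c = true then (1 : ℝ) else 0)).comp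
    (measurable_pi_apply x)

/-- The one particle density `ρ₁(x) = ⟨η(x)⟩`. -/
noncomputable def density {X : Type*} (μ : MeasureTheory.Measure (Configuration X)) (x : X) : ℝ :=
  ∫ ω, empiricalField x ω ∂μ

open Classical in
/-- The pair density `ρ₂(x, y) = ⟨η(x) η(y)⟩ - ρ₁(x) δ_{x,y}`. -/
noncomputable def pairDensity {X : Type*} (μ : MeasureTheory.Measure (Configuration X))
    (x y : X) : ℝ :=
  (∫ ω, empiricalField x ω * empiricalField y ω ∂μ) - (if x = y then density μ x else 0)

/-- The point process with law `μ` realizes `(ρ₁, G₂)`: its one particle density is `ρ₁` and its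
pair density is `ρ₂(x, y) = ρ₁(x) ρ₁(y) G₂(x, y)` at distinct sites. (At coinciding sites the pair
density of every point process vanishes, see `pairDensity_self`, so that nothing is prescribed
there.) -/
structure Realizes {X : Type*} (μ : MeasureTheory.Measure (Configuration X))
    (ρ₁ : X → ℝ) (G₂ : X → X → ℝ) : Prop where
  density_eq : ∀ x, density μ x = ρ₁ x
  pairDensity_eq : ∀ x y, x ≠ y → pairDensity μ x y = ρ₁ x * ρ₁ y * G₂ x y

/-- `(ρ₁, G₂)` is realizable: some point process (probability measure on configurations)
realizes it. -/
def Realizable {X : Type*} (ρ₁ : X → ℝ) (G₂ : X → X → ℝ) : Prop :=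
  ∃ μ : MeasureTheory.Measure (Configuration X),
    MeasureTheory.IsProbabilityMeasure μ ∧ Realizes μ ρ₁ G₂

/-- The constant `b = sup_x ∏_{y ≠ x} G₂(x, y)`, with values in `[0, ∞]`. The product is the
unconditional one; when `G₂ ≥ 1` off the diagonal it always exists, see `tprod_eq_iSup`. -/
noncomputable def supProd {X : Type*} (G₂ : X → X → ℝ) : ℝ≥0∞ :=
  ⨆ x : X, ∏' y : {y : X // y ≠ x}, ENNReal.ofReal (G₂ x y)

theorem pairDensity_self {X : Type*} (μ : MeasureTheory.Measure (Configuration X)) (x : X) :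
    pairDensity μ x x = 0 := by
  have h : ∀ ω : Configuration X,
      empiricalField x ω * empiricalField x ω = empiricalField x ω := by
    intro ω
    unfold empiricalField
    split_ifs <;> norm_num
  simp [pairDensity, density, h]

/-- Unconditional products of factors `≥ 1` exist in `[0, ∞]` and are the suprema of the finite
partial products. -/
theorem hasProd_iSup {ι : Type*} (f : ι → ℝ≥0∞) (hf : ∀ i, 1 ≤ f i) :
    HasProd f (⨆ s : Finset ι, ∏ i ∈ s, f i) :=
  tendsto_atTop_iSup fun _ _ hst =>
    Finset.prod_le_prod_of_subset_of_one_le' hst fun i _ _ => hf i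

theorem tprod_eq_iSup {X : Type*} (G₂ : X → X → ℝ) (hG : ∀ x y, x ≠ y → 1 ≤ G₂ x y) (x : X) :
    ∏' y : {y : X // y ≠ x}, ENNReal.ofReal (G₂ x y) =
      ⨆ s : Finset {y : X // y ≠ x}, ∏ y ∈ s, ENNReal.ofReal (G₂ x y) :=
  (hasProd_iSup (fun y : {y : X // y ≠ x} => ENNReal.ofReal (G₂ x y))
    fun y => ENNReal.one_le_ofReal.2 (hG x y y.2.symm)).tprod_eq

end LatticePointProcess

/-! Prescribe all correlations at once by the product ansatz: `ρ ^ n` times the product of `G₂` over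
the pairs. In a finite `Λ`, inclusion-exclusion forces the weight of a configuration `A`; it factors
as the correlation of `A` times a partition function on `Λ \ A` at negative activity, tilted by `A`.
The bound `ρ * b ≤ 1` makes that activity admissible, and `alternatingPartition_nonneg` then gives
nonnegative weights. As `{0,1}^X` is compact and second moments are integrals of continuous
functions, a limit point of the finite-volume laws realizes the pair. -/

namespace LatticePointProcess

open Finset MeasureTheory Filter
open scoped Topology

/-! ### Positivity of the partition function at negative activity -/

section FiniteVolume

variable {X : Type*}

/-- The correlation function `∏_{x ∈ B} z x * ∏_{{x, y} ⊆ B} G x y` with activity `z` and pair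
factor `G`; every unordered pair is met twice in `B.offDiag`, whence the square root. -/
noncomputable def pairCorrelation (G : X → X → ℝ) (z : X → ℝ) (B : Finset X) : ℝ :=
  (∏ x ∈ B, z x) * ∏ p ∈ B.offDiag, √(G p.1 p.2)

/-- The grand partition function of `Λ` at the negative activity `-z`. -/
noncomputable def alternatingPartition (G : X → X → ℝ) (z : X → ℝ) (Λ : Finset X) : ℝ :=
  ∑ C ∈ Λ.powerset, (-1) ^ #C * pairCorrelation G z C

theorem pairCorrelation_empty (G : X → X → ℝ) (z : X → ℝ) : pairCorrelation G z ∅ = 1 := by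
  simp [pairCorrelation]

theorem pairCorrelation_congr (G : X → X → ℝ) {z z' : X → ℝ} {B : Finset X}
    (h : ∀ x ∈ B, z x = z' x) : pairCorrelation G z B = pairCorrelation G z' B := by
  unfold pairCorrelation
  rw [prod_congr rfl h]

theorem pairCorrelation_nonneg {G : X → X → ℝ} {z : X → ℝ} {B : Finset X}
    (hz : ∀ x ∈ B, 0 ≤ z x) : 0 ≤ pairCorrelation G z B :=
  mul_nonneg (prod_nonneg hz) (prod_nonneg fun _ _ => Real.sqrt_nonneg _)

theorem alternatingPartition_congr (G : X → X → ℝ) {z z' : X → ℝ} {Λ : Finset X}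
    (h : ∀ x ∈ Λ, z x = z' x) : alternatingPartition G z Λ = alternatingPartition G z' Λ :=
  sum_congr rfl fun C hC => by
    rw [pairCorrelation_congr G fun x hx => h x (mem_powerset.1 hC hx)]

variable [DecidableEq X]

theorem pairCorrelation_insert {G : X → X → ℝ} (hsymm : ∀ x y, G x y = G y x)
    (hG : ∀ x y, x ≠ y → 1 ≤ G x y) (z : X → ℝ) {x : X} {B : Finset X} (hx : x ∉ B) :
    pairCorrelation G z (insert x B) = z x * pairCorrelation G (fun y => z y * G x y) B := by
  have hd₁ : Disjoint B.offDiag ({x} ×ˢ B) := by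
    rw [Finset.disjoint_left]; rintro ⟨a, b⟩ h h'; simp at h h'; grind
  have hd₂ : Disjoint (B.offDiag ∪ {x} ×ˢ B) (B ×ˢ {x}) := by
    rw [Finset.disjoint_left]; rintro ⟨a, b⟩ h h'; simp at h h'; grind
  have hpair : (∏ y ∈ B, √(G x y)) * ∏ y ∈ B, √(G y x) = ∏ y ∈ B, G x y := by
    rw [← prod_mul_distrib]
    refine prod_congr rfl fun y hy => ?_
    rw [hsymm y x, Real.mul_self_sqrt]
    exact zero_le_one.trans (hG x y fun h => hx (h ▸ hy))
  unfold pairCorrelation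
  rw [prod_insert hx, offDiag_insert hx, prod_union hd₂, prod_union hd₁, prod_product,
    prod_product_right, prod_singleton, prod_singleton, prod_mul_distrib, ← hpair]
  ring

/-- The pairs between `A` and `C` are absorbed into the activity on `C`, so `A` acts as an external
field. -/
theorem pairCorrelation_union {G : X → X → ℝ} (hsymm : ∀ x y, G x y = G y x)
    (hG : ∀ x y, x ≠ y → 1 ≤ G x y) (z : X → ℝ) {A C : Finset X} (h : Disjoint A C) :
    pairCorrelation G z (A ∪ C) =
      pairCorrelation G z A * pairCorrelation G (fun y => z y * ∏ a ∈ A, G a y) C := by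
  induction A using Finset.induction_on generalizing z with
  | empty => simp [pairCorrelation_empty]
  | insert x A hx ih =>
    rw [disjoint_insert_left] at h
    rw [insert_union, pairCorrelation_insert hsymm hG z (by simp [hx, h.1]), ih _ h.2,
      pairCorrelation_insert hsymm hG z hx, mul_assoc]
    simp_rw [prod_insert hx, mul_assoc]

theorem alternatingPartition_insert {G : X → X → ℝ} (hsymm : ∀ x y, G x y = G y x)
    (hG : ∀ x y, x ≠ y → 1 ≤ G x y) (z : X → ℝ) {x : X} {Λ : Finset X} (hx : x ∉ Λ) :
    alternatingPartition G z (insert x Λ) =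
      alternatingPartition G z Λ - z x * alternatingPartition G (fun y => z y * G x y) Λ := by
  unfold alternatingPartition
  rw [sum_powerset_insert hx, sub_eq_add_neg, mul_sum, ← sum_neg_distrib]
  congr 1
  refine sum_congr rfl fun C hC => ?_
  have hxC : x ∉ C := fun h => hx (mem_powerset.1 hC h)
  rw [card_insert_of_notMem hxC, pairCorrelation_insert hsymm hG z hxC]
  ring

/-- The activity `z` is admissible in `Λ` if it is nonnegative and
`z x * ∏_{y ∈ Λ \ {x}} G x y ≤ 1` for all `x ∈ Λ`. -/
structure Admissible (G : X → X → ℝ) (z : X → ℝ) (Λ : Finset X) : Prop where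
  nonneg : ∀ x ∈ Λ, 0 ≤ z x
  mul_prod_le_one : ∀ x ∈ Λ, z x * ∏ y ∈ Λ.erase x, G x y ≤ 1

/-- The factor `G x y` merely moves from the product over the volume into the activity. -/
theorem Admissible.tilt {G : X → X → ℝ} (hsymm : ∀ x y, G x y = G y x)
    (hG : ∀ x y, x ≠ y → 1 ≤ G x y) {z : X → ℝ} {x : X} {Λ : Finset X} (hx : x ∉ Λ)
    (h : Admissible G z (insert x Λ)) : Admissible G (fun y => z y * G x y) Λ where
  nonneg y hy := mul_nonneg (h.nonneg y (mem_insert_of_mem hy))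
    (zero_le_one.trans (hG x y fun e => hx (e ▸ hy)))
  mul_prod_le_one y hy := by
    have hxy : y ≠ x := fun e => hx (e ▸ hy)
    have := h.mul_prod_le_one y (mem_insert_of_mem hy)
    rwa [erase_insert_of_ne hxy.symm, prod_insert (by simp [hx]), ← mul_assoc, hsymm y x] at this

theorem Admissible.of_le {G : X → X → ℝ} (hG : ∀ x y, x ≠ y → 1 ≤ G x y) {z z' : X → ℝ}
    {Λ : Finset X} (h : Admissible G z' Λ) (h0 : ∀ x ∈ Λ, 0 ≤ z x)
    (hle : ∀ x ∈ Λ, z x ≤ z' x) : Admissible G z Λ where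
  nonneg := h0
  mul_prod_le_one x hx := (mul_le_mul_of_nonneg_right (hle x hx) (prod_nonneg fun y hy =>
    zero_le_one.trans (hG x y (ne_of_mem_erase hy).symm))).trans (h.mul_prod_le_one x hx)

/-- Antitonicity of the partition function in the activity, given positivity in smaller
volumes. -/
theorem alternatingPartition_antitone {G : X → X → ℝ} (hsymm : ∀ x y, G x y = G y x)
    (hG : ∀ x y, x ≠ y → 1 ≤ G x y) {Λ : Finset X}
    (hpos : ∀ Λ' : Finset X, #Λ' < #Λ → ∀ z, Admissible G z Λ' → 0 ≤ alternatingPartition G z Λ')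
    {z z' : X → ℝ} (h : Admissible G z' Λ) (h0 : ∀ x ∈ Λ, 0 ≤ z x)
    (hle : ∀ x ∈ Λ, z x ≤ z' x) :
    alternatingPartition G z' Λ ≤ alternatingPartition G z Λ := by
  -- Raise the activity from `z` to `z'` one site at a time.
  have key : ∀ T ⊆ Λ, alternatingPartition G (T.piecewise z' z) Λ ≤
      alternatingPartition G z Λ := by
    intro T
    induction T using Finset.induction_on with
    | empty => simp
    | insert w T hw ih =>
      intro hT
      obtain ⟨hwΛ, hTΛ⟩ := insert_subset_iff.1 hT
      refine le_trans ?_ (ih hTΛ)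
      have hadm : Admissible G (T.piecewise z' z) Λ := by
        refine h.of_le hG (fun x hx => ?_) fun x hx => ?_
        · by_cases hxT : x ∈ T <;> simp [hxT, h0 x hx, h.nonneg x hx]
        · by_cases hxT : x ∈ T <;> simp [hxT, hle x hx]
      rw [← insert_erase hwΛ] at hadm
      have hagree : ∀ y ∈ Λ.erase w, (insert w T).piecewise z' z y = T.piecewise z' z y :=
        fun y hy => by simp [Finset.piecewise, ne_of_mem_erase hy]
      have h1 := hpos (Λ.erase w) (card_erase_lt_of_mem hwΛ) _
        (hadm.tilt hsymm hG (notMem_erase w Λ))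
      -- The partition function is affine in the activity at `w`, with slope minus the tilted one on
      -- `Λ.erase w`, which is nonnegative by `h1`.
      rw [← insert_erase hwΛ, alternatingPartition_insert hsymm hG _ (notMem_erase w Λ),
        alternatingPartition_insert hsymm hG _ (notMem_erase w Λ),
        alternatingPartition_congr G hagree,
        alternatingPartition_congr G (z := fun y => (insert w T).piecewise z' z y * G w y)
          (z' := fun y => T.piecewise z' z y * G w y) fun y hy => by simp only [hagree y hy]]
      have h2 : (insert w T).piecewise z' z w = z' w := by simp
      have h3 : T.piecewise z' z w = z w := by simp [hw]
      rw [h2, h3]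
      exact sub_le_sub_left (mul_le_mul_of_nonneg_right (hle w hwΛ) h1) _
  refine le_trans (le_of_eq ?_) (key Λ Subset.rfl)
  exact alternatingPartition_congr G fun x hx => by simp [hx]

/-- Removing `x` leaves `Ξ(z) - z x * Ξ(z * G x ·)`. Tilting raises the activity, so antitonicity
gives `Ξ(z * G x ·) ≤ Ξ(z)`; admissibility gives `z x ≤ 1`. -/
theorem alternatingPartition_nonneg {G : X → X → ℝ} (hsymm : ∀ x y, G x y = G y x)
    (hG : ∀ x y, x ≠ y → 1 ≤ G x y) {z : X → ℝ} {Λ : Finset X} (h : Admissible G z Λ) :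
    0 ≤ alternatingPartition G z Λ := by
  induction hn : #Λ using Nat.strong_induction_on generalizing Λ z with
  | _ n ih =>
    obtain rfl | ⟨x, hx⟩ := Λ.eq_empty_or_nonempty
    · simp [alternatingPartition, pairCorrelation_empty]
    obtain ⟨s, hxs, rfl⟩ : ∃ s, x ∉ s ∧ insert x s = Λ :=
      ⟨Λ.erase x, notMem_erase x Λ, insert_erase hx⟩
    have hs : #s < n := by rw [← hn, card_insert_of_notMem hxs]; omega
    have htilt := h.tilt hsymm hG hxs
    have hge : ∀ y ∈ s, 1 ≤ G x y := fun y hy => hG x y fun e => hxs (e ▸ hy)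
    have h0 : ∀ y ∈ s, 0 ≤ z y := fun y hy => h.nonneg y (mem_insert_of_mem hy)
    have h1 : 0 ≤ alternatingPartition G (fun y => z y * G x y) s := ih _ hs htilt rfl
    have h2 : alternatingPartition G (fun y => z y * G x y) s ≤ alternatingPartition G z s :=
      alternatingPartition_antitone hsymm hG
        (fun Λ' hΛ' z' hz' => ih _ (hΛ'.trans hs) hz' rfl) htilt h0
        fun y hy => le_mul_of_one_le_right (h0 y hy) (hge y hy)
    have h3 : z x ≤ 1 := by
      have h4 := h.mul_prod_le_one x (mem_insert_self x s)
      rw [erase_insert hxs] at h4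
      have h5 : 1 ≤ ∏ y ∈ s, G x y := by
        simpa using prod_le_prod (fun _ _ => zero_le_one) hge
      exact (le_mul_of_one_le_right (h.nonneg x (mem_insert_self x s)) h5).trans h4
    rw [alternatingPartition_insert hsymm hG z hxs, sub_nonneg]
    exact (mul_le_of_le_one_left h1 h3).trans h2

/-! ### Finite-volume laws by inclusion-exclusion -/

/-- The inclusion-exclusion weight of the configuration `A` in the volume `Λ`, for the
correlation functions `c`. -/
def inclusionExclusionWeight (c : Finset X → ℝ) (Λ A : Finset X) : ℝ :=
  ∑ C ∈ (Λ \ A).powerset, (-1) ^ #C * c (A ∪ C)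

theorem sum_inclusionExclusionWeight (c : Finset X → ℝ) {D Λ : Finset X} (hD : D ⊆ Λ) :
    ∑ A ∈ Λ.powerset with D ⊆ A, inclusionExclusionWeight c Λ A = c D := by
  unfold inclusionExclusionWeight
  -- Regroup by `B = A ∪ C`; the alternating sum over `E ⊆ B \ D` then vanishes unless `B = D`.
  have hswap : ∑ A ∈ Λ.powerset with D ⊆ A, ∑ C ∈ (Λ \ A).powerset, (-1) ^ #C * c (A ∪ C) =
      ∑ B ∈ Λ.powerset with D ⊆ B, ∑ E ∈ (B \ D).powerset, (-1) ^ #E * c B := by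
    rw [sum_sigma', sum_sigma']
    refine sum_nbij' (fun p => ⟨p.1 ∪ p.2, p.2⟩) (fun p => ⟨p.1 \ p.2, p.2⟩) ?_ ?_ ?_ ?_ ?_
    · rintro ⟨A, C⟩ h
      simp only [mem_sigma, mem_filter, mem_powerset] at h ⊢
      grind
    · rintro ⟨A, C⟩ h
      simp only [mem_sigma, mem_filter, mem_powerset] at h ⊢
      grind
    · rintro ⟨A, C⟩ h
      simp only [mem_sigma, mem_filter, mem_powerset] at h ⊢
      have : (A ∪ C) \ C = A := by grind
      rw [this]
    · rintro ⟨A, C⟩ h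
      simp only [mem_sigma, mem_filter, mem_powerset] at h ⊢
      have : A \ C ∪ C = A := by grind
      rw [this]
    · simp
  have hinner (B : Finset X) : ∑ E ∈ (B \ D).powerset, (-1 : ℝ) ^ #E * c B =
      if B \ D = ∅ then c B else 0 := by
    have := sum_powerset_neg_one_pow_card (x := B \ D)
    rw [← sum_mul, show ∑ E ∈ (B \ D).powerset, (-1 : ℝ) ^ #E =
      ((∑ E ∈ (B \ D).powerset, (-1 : ℤ) ^ #E : ℤ) : ℝ) by push_cast; rfl, this]
    split_ifs <;> simp
  rw [hswap, sum_congr rfl fun B _ => hinner B, sum_eq_single D]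
  · simp
  · intro B hB hne
    rw [if_neg]
    intro h
    exact hne (Subset.antisymm (sdiff_eq_empty_iff_subset.1 h) (mem_filter.1 hB).2)
  · simp [hD]

/-- The point process in `Λ` with given weights of the configurations. -/
noncomputable def finiteVolumeLaw (w : Finset X → ℝ) (Λ : Finset X) :
    Measure (Configuration X) :=
  ∑ A ∈ Λ.powerset, ENNReal.ofReal (w A) • Measure.dirac fun x => decide (x ∈ A)

theorem isProbabilityMeasure_finiteVolumeLaw {w : Finset X → ℝ} {Λ : Finset X}
    (hw : ∀ A ⊆ Λ, 0 ≤ w A) (h1 : ∑ A ∈ Λ.powerset, w A = 1) :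
    IsProbabilityMeasure (finiteVolumeLaw w Λ) := by
  constructor
  simp only [finiteVolumeLaw, Measure.coe_finsetSum, Finset.sum_apply, Measure.smul_apply,
    measure_univ, smul_eq_mul, mul_one]
  rw [← ENNReal.ofReal_sum_of_nonneg fun A hA => hw A (mem_powerset.1 hA), h1,
    ENNReal.ofReal_one]

theorem integral_finiteVolumeLaw {w : Finset X → ℝ} {Λ : Finset X}
    (hw : ∀ A ⊆ Λ, 0 ≤ w A) {f : Configuration X → ℝ} (hf : StronglyMeasurable f) :
    ∫ ω, f ω ∂finiteVolumeLaw w Λ = ∑ A ∈ Λ.powerset, w A * f fun x => decide (x ∈ A) := by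
  unfold finiteVolumeLaw
  rw [integral_finsetSum_measure]
  · refine sum_congr rfl fun A hA => ?_
    rw [integral_smul_measure, integral_dirac' _ _ hf,
      ENNReal.toReal_ofReal (hw A (mem_powerset.1 hA)), smul_eq_mul]
  · intro A _
    exact (integrable_dirac' hf (by simp)).smul_measure ENNReal.ofReal_ne_top

theorem integral_mul_finiteVolumeLaw {c : Finset X → ℝ} {Λ : Finset X}
    (hw : ∀ A ⊆ Λ, 0 ≤ inclusionExclusionWeight c Λ A) {x y : X} (hx : x ∈ Λ) (hy : y ∈ Λ) :
    ∫ ω, empiricalField x ω * empiricalField y ω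
      ∂finiteVolumeLaw (inclusionExclusionWeight c Λ) Λ = c {x, y} := by
  have hmeas : Measurable fun ω : Configuration X => empiricalField x ω * empiricalField y ω :=
    (measurable_empiricalField x).mul (measurable_empiricalField y)
  rw [integral_finiteVolumeLaw hw hmeas.stronglyMeasurable,
    ← sum_inclusionExclusionWeight c (insert_subset hx (singleton_subset_iff.2 hy)), sum_filter]
  refine sum_congr rfl fun A _ => ?_
  by_cases h1 : x ∈ A <;> by_cases h2 : y ∈ A <;>
    simp [empiricalField, h1, h2, insert_subset_iff]

end FiniteVolume

/-! ### Infinite-volume limit by compactness -/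

theorem continuous_empiricalField {X : Type*} (x : X) :
    Continuous (empiricalField x : Configuration X → ℝ) :=
  (continuous_of_discreteTopology (f := fun c : Bool => if c = true then (1 : ℝ) else 0)).comp
    (continuous_apply x)

theorem empiricalField_mul_self {X : Type*} (x : X) (ω : Configuration X) :
    empiricalField x ω * empiricalField x ω = empiricalField x ω := by
  unfold empiricalField
  split_ifs <;> norm_num

/-- Passage to the infinite volume limit: prescribed second moments which are attained in all
finite volumes are attained by a point process. -/
theorem exists_isProbabilityMeasure_of_finiteVolume {X : Type*} [Countable X]
    (m : X → X → ℝ)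
    (h : ∀ Λ : Finset X, ∃ μ : Measure (Configuration X), IsProbabilityMeasure μ ∧
      ∀ x ∈ Λ, ∀ y ∈ Λ, ∫ ω, empiricalField x ω * empiricalField y ω ∂μ = m x y) :
    ∃ μ : Measure (Configuration X), IsProbabilityMeasure μ ∧
      ∀ x y, ∫ ω, empiricalField x ω * empiricalField y ω ∂μ = m x y := by
  classical
  choose μ hprob hμ using h
  let ν : Finset X → ProbabilityMeasure (Configuration X) := fun Λ => ⟨μ Λ, hprob Λ⟩
  let U : Ultrafilter (Finset X) := Ultrafilter.of atTop
  obtain ⟨P, -, hP⟩ := isCompact_univ.ultrafilter_le_nhds (U.map ν) (by simp)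
  have hP' : Tendsto ν U (𝓝 P) := hP
  refine ⟨P, inferInstance, fun x y => ?_⟩
  let f : BoundedContinuousFunction (Configuration X) ℝ :=
    BoundedContinuousFunction.mkOfCompact ⟨fun ω => empiricalField x ω * empiricalField y ω,
      (continuous_empiricalField x).mul (continuous_empiricalField y)⟩
  have hlim := ProbabilityMeasure.tendsto_iff_forall_integral_tendsto.1 hP' f
  refine tendsto_nhds_unique hlim (tendsto_const_nhds.congr' ?_)
  refine (Ultrafilter.of_le atTop) ?_
  -- The moment is constant once the volume contains both sites.
  filter_upwards [eventually_ge_atTop ({x, y} : Finset X)] with Λ hΛ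
  exact (hμ Λ x (hΛ (by simp)) y (hΛ (by simp))).symm

theorem mul_prod_le_one_of_le_inv_supProd {X : Type*} {G₂ : X → X → ℝ}
    (hG : ∀ x y, x ≠ y → 1 ≤ G₂ x y) {ρ : ℝ} (hρ₀ : 0 ≤ ρ)
    (hρ : ENNReal.ofReal ρ ≤ (supProd G₂)⁻¹) {x : X} {s : Finset X} (hx : x ∉ s) :
    ρ * ∏ y ∈ s, G₂ x y ≤ 1 := by
  classical
  have hprod : ∏ y ∈ s, ENNReal.ofReal (G₂ x y) ≤ supProd G₂ := by
    refine le_trans ?_ (le_iSup _ x)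
    rw [tprod_eq_iSup G₂ hG x]
    refine le_trans (le_of_eq ?_) (le_iSup _ (s.subtype (· ≠ x)))
    rw [prod_subtype_eq_prod_filter (f := fun y => ENNReal.ofReal (G₂ x y)),
      filter_true_of_mem fun y hy => ne_of_mem_of_not_mem hy hx]
  have hnonneg : ∀ y ∈ s, 0 ≤ G₂ x y :=
    fun y hy => zero_le_one.trans (hG x y fun e => hx (e ▸ hy))
  rw [← ENNReal.ofReal_prod_of_nonneg hnonneg] at hprod
  rw [← ENNReal.ofReal_le_one, ENNReal.ofReal_mul hρ₀]
  exact (mul_le_mul' hρ hprod).trans (ENNReal.inv_mul_le_one _)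

end LatticePointProcess

open LatticePointProcess Finset in
theorem mainTheorem3 {X : Type*} [Countable X] (G₂ : X → X → ℝ)
    (hsymm : ∀ x y, G₂ x y = G₂ y x)
    (hG : ∀ x y, x ≠ y → 1 ≤ G₂ x y)
    (hb : LatticePointProcess.supProd G₂ < ∞)
    (ρ : ℝ) (hρ₀ : 0 ≤ ρ)
    (hρ : ENNReal.ofReal ρ ≤ (LatticePointProcess.supProd G₂)⁻¹) :
    LatticePointProcess.Realizable (fun _ => ρ) G₂ := by
  classical
  let c : Finset X → ℝ := pairCorrelation G₂ fun _ => ρ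
  have hw : ∀ Λ : Finset X, ∀ A ⊆ Λ, 0 ≤ inclusionExclusionWeight c Λ A := by
    intro Λ A _
    have hfactor : inclusionExclusionWeight c Λ A =
        c A * alternatingPartition G₂ (fun y => ρ * ∏ a ∈ A, G₂ a y) (Λ \ A) := by
      unfold inclusionExclusionWeight alternatingPartition
      rw [mul_sum]
      refine sum_congr rfl fun C hC => ?_
      have hdisj : Disjoint A C :=
        (disjoint_sdiff (s := A) (t := Λ)).mono_right (mem_powerset.1 hC)
      simp only [c, pairCorrelation_union hsymm hG _ hdisj]
      ring
    rw [hfactor]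
    refine mul_nonneg (pairCorrelation_nonneg fun _ _ => hρ₀)
      (alternatingPartition_nonneg hsymm hG ⟨fun x hx => ?_, fun x hx => ?_⟩)
    · have hxA := (mem_sdiff.1 hx).2
      exact mul_nonneg hρ₀ (prod_nonneg fun a ha =>
        zero_le_one.trans (hG a x fun e => hxA (e ▸ ha)))
    · have hxA := (mem_sdiff.1 hx).2
      have hdisj : Disjoint A ((Λ \ A).erase x) :=
        (disjoint_sdiff (s := A) (t := Λ)).mono_right (erase_subset _ _)
      -- The tilt by `A` and the product over the other sites of `Λ \ A` merge into one product over
      -- sites distinct from `x`, at most `b`.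
      simp only [hsymm _ x]
      rw [mul_assoc, ← prod_union hdisj]
      exact mul_prod_le_one_of_le_inv_supProd hG hρ₀ hρ (by simp [hxA])
  obtain ⟨μ, hprob, hμ⟩ := exists_isProbabilityMeasure_of_finiteVolume (fun x y => c {x, y})
    fun Λ => ⟨finiteVolumeLaw (inclusionExclusionWeight c Λ) Λ,
      isProbabilityMeasure_finiteVolumeLaw (hw Λ) (by
        simpa [c, pairCorrelation_empty] using
          sum_inclusionExclusionWeight c (empty_subset Λ)),
      fun x hx y hy => integral_mul_finiteVolumeLaw (hw Λ) hx hy⟩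
  have hc_single (x : X) : c {x} = ρ := by simp [c, pairCorrelation]
  refine ⟨μ, hprob, fun x => ?_, fun x y hxy => ?_⟩
  -- The density is the diagonal second moment, since `η(x)² = η(x)` and `{x, x} = {x}`.
  · simpa [empiricalField_mul_self, density, hc_single] using hμ x x
  · rw [pairDensity, if_neg hxy, sub_zero, hμ x y]
    simp only [c]
    rw [pairCorrelation_insert hsymm hG _ (by simpa using hxy)]
    simp [pairCorrelation, mul_assoc]
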